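/- Let $n$ be a number of qubits, let $\mathcal H=(\mathbb C^2)^{\otimes n}$, and let $H_0,H_1$ be Hermitian operators on $\mathcal H$. For $0\le s\le 1$ put $H_s=(1-s)H_0+sH_1$, let $\lambda_0(s)\le\lambda_1(s)\le\cdots$ be the eigenvalues of $H_s$ listed with multiplicity, and let $\Delta=\min_{0\le s\le 1}\bigl(\lambda_1(s)-\lambda_0(s)\bigr)$ be the minimal spectral gap. Let $\alpha_0$ and $\alpha_1$ be normalized ground states of $H_0$ and $H_1$, respectively. Let $\mathcal V\subseteq\mathcal H$ be a subspace spanned by eigenvectors of $H_0$ whose orthogonal projection $\Pi_{\mathcal V}$ satisfies $\|\Pi_{\mathcal V}\alpha_0\|=1$ and $\|\Pi_{\mathcal V}\alpha_1\|\le 1/10$, and let $$\beta=\max_{v\in\mathcal V,\ \|v\|=1}\bigl\|\Pi_{\mathcal V^\perp}H_1v\bigr\|$$ be the escape rate of $\mathcal V$ by $H_1$. Then $$\Delta\le\bigl(100\,\beta\,\|H_0-H_1\|^3\bigr)^{1/4},$$ where $\|\cdot\|$ is the operator norm. -/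

import Mathlib

noncomputable section

namespace Adiabatic

/-- The state space `(ℂ²)^{⊗ n}` of `n` qubits, a Hilbert space whose standard orthonormal basis is
indexed by the bit strings of length `n`. -/
abbrev Qubits (n : ℕ) : Type := EuclideanSpace ℂ (Fin n → Fin 2)

/-- Operators on `n` qubits, with the operator norm. -/
abbrev Op (n : ℕ) : Type := Qubits n →L[ℂ] Qubits n

/-- Hermitian operators, i.e. Hamiltonians: `⟪H x, y⟫ = ⟪x, H y⟫` for all `x`, `y`. -/
abbrev IsHermitian {n : ℕ} (H : Op n) : Prop := (H : Qubits n →ₗ[ℂ] Qubits n).IsSymmetric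

theorem finrank_qubits (n : ℕ) : Module.finrank ℂ (Qubits n) = 2 ^ n := by
  simp [Qubits]

/-- The `2 ^ n` eigenvalues of a Hamiltonian, repeated according to multiplicity and listed in
increasing order (Mathlib lists them in decreasing order). -/
def energyLevel {n : ℕ} (H : Op n) (hH : IsHermitian H) (k : Fin (2 ^ n)) : ℝ :=
  hH.eigenvalues (finrank_qubits n) k.rev

theorem energyLevel_monotone {n : ℕ} (H : Op n) (hH : IsHermitian H) :
    Monotone (energyLevel H hH) := fun _ _ h =>
  hH.eigenvalues_antitone (finrank_qubits n) (Fin.rev_le_rev.mpr h)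

/-- `α` is a (normalized) ground state of `H`: a unit eigenvector for the lowest eigenvalue. -/
def IsGroundState {n : ℕ} (H : Op n) (hH : IsHermitian H) (α : Qubits n) : Prop :=
  ‖α‖ = 1 ∧ H α = (energyLevel H hH 0 : ℂ) • α

/-- The spectral gap `λ₁ - λ₀` between the two lowest eigenvalues, counted with multiplicity
(so that it is `0` exactly when the ground state is degenerate). For `n = 0` there is only one
eigenvalue and the value is `0`. -/
def spectralGap {n : ℕ} (H : Op n) (hH : IsHermitian H) : ℝ :=
  energyLevel H hH 1 - energyLevel H hH 0

/-- The interpolation `H_s = (1 - s) H₀ + s H₁`. -/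
def interp {n : ℕ} (H₀ H₁ : Op n) (s : ℝ) : Op n :=
  ((1 - s : ℝ) : ℂ) • H₀ + (s : ℂ) • H₁

theorem isHermitian_interp {n : ℕ} {H₀ H₁ : Op n} (h₀ : IsHermitian H₀) (h₁ : IsHermitian H₁)
    (s : ℝ) : IsHermitian (interp H₀ H₁ s) :=
  (h₀.smul (Complex.conj_ofReal _)).add (h₁.smul (Complex.conj_ofReal _))

/-- The minimal gap `Δ = min_{0 ≤ s ≤ 1} (λ₁(H_s) - λ₀(H_s))` of the interpolation. The gap is
nonnegative and depends continuously on `s`, so this infimum is a minimum. -/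
def minGap {n : ℕ} (H₀ H₁ : Op n) (h₀ : IsHermitian H₀) (h₁ : IsHermitian H₁) : ℝ :=
  ⨅ s : Set.Icc (0 : ℝ) 1, spectralGap (interp H₀ H₁ s) (isHermitian_interp h₀ h₁ s)

/-- The subspace `V` is spanned by eigenvectors of `H`. -/
def SpannedByEigenstates {n : ℕ} (H : Op n) (V : Submodule ℂ (Qubits n)) : Prop :=
  ∃ S : Set (Qubits n),
    (∀ v ∈ S, ∃ μ : ℂ, Module.End.HasEigenvector (H : Qubits n →ₗ[ℂ] Qubits n) μ v) ∧
    V = Submodule.span ℂ S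

/-- `β` is the escape rate of the subspace `V` by `H`: the maximum of `‖Π_{V^⊥} H v‖` over the
states (unit vectors) `v ∈ V`. -/
def IsEscapeRate {n : ℕ} (V : Submodule ℂ (Qubits n)) (H : Op n) (β : ℝ) : Prop :=
  IsGreatest {r : ℝ | ∃ v ∈ V, ‖v‖ = 1 ∧ r = ‖Vᗮ.starProjection (H v)‖} β

end Adiabatic

end

namespace Adiabatic

variable {n : ℕ}

open scoped InnerProductSpace

/-! Only two estimates are needed: Δ ≤ 2β and β ≤ ‖H₀ - H₁‖, which give Δ⁴ ≤ 16β⁴ ≤ 100 β ‖H₀ -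
H₁‖³. The second holds because H₀ preserves V, so only H₁ - H₀ can leave it. For the first, the
weight of the ground state on V falls from 1 to at most 1/100 along the path. By an intermediate
value argument (`exists_isMinimizer_both_sides`), some H_s is either degenerate, with gap 0, or has
a ground state x + y with x ∈ V, y ∈ Vᗮ of equal norm. Then x - y is orthogonal to it, and the two
energies differ only in the cross term, which β controls (`spectralGap_le_of_balanced`). -/

/-! ### Variational description of the two lowest levels -/

/-- The expectation value of `H` in terms of its energy levels. -/
theorem re_inner_apply_eq_sum (H : Op n) (hH : IsHermitian H) (x : Qubits n) :
    (⟪x, H x⟫_ℂ).re = ∑ k, hH.eigenvalues (finrank_qubits n) k *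
      ‖⟪hH.eigenvectorBasis (finrank_qubits n) k, x⟫_ℂ‖ ^ 2 := by
  set e := hH.eigenvectorBasis (finrank_qubits n)
  rw [← e.sum_inner_mul_inner x (H x), Complex.re_sum]
  refine Finset.sum_congr rfl fun k _ => ?_
  have h1 : ⟪e k, H x⟫_ℂ = (hH.eigenvalues (finrank_qubits n) k : ℂ) * ⟪e k, x⟫_ℂ := by
    have := hH.eigenvectorBasis_apply_self_apply (finrank_qubits n) x k
    rwa [OrthonormalBasis.repr_apply_apply, OrthonormalBasis.repr_apply_apply] at this
  rw [h1, ← inner_conj_symm x (e k), mul_left_comm, Complex.conj_mul']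
  rw [← Complex.ofReal_pow, ← Complex.ofReal_mul, Complex.ofReal_re]

theorem norm_sq_eq_sum (H : Op n) (hH : IsHermitian H) (x : Qubits n) :
    ‖x‖ ^ 2 = ∑ k, ‖⟪hH.eigenvectorBasis (finrank_qubits n) k, x⟫_ℂ‖ ^ 2 :=
  ((hH.eigenvectorBasis (finrank_qubits n)).sum_sq_norm_inner_right x).symm

/-- The index of the lowest energy in Mathlib's decreasing order. -/
abbrev bottom (n : ℕ) : Fin (2 ^ n) := Fin.rev 0

/-- The standard ground state of a Hamiltonian. -/
noncomputable def groundVector (H : Op n) (hH : IsHermitian H) : Qubits n :=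
  hH.eigenvectorBasis (finrank_qubits n) (bottom n)

theorem isGroundState_groundVector (H : Op n) (hH : IsHermitian H) :
    IsGroundState H hH (groundVector H hH) :=
  ⟨(hH.eigenvectorBasis (finrank_qubits n)).norm_eq_one _,
    hH.apply_eigenvectorBasis (finrank_qubits n) _⟩

theorem energyLevel_zero_le_eigenvalues (H : Op n) (hH : IsHermitian H) (k : Fin (2 ^ n)) :
    energyLevel H hH 0 ≤ hH.eigenvalues (finrank_qubits n) k := by
  simpa [energyLevel] using energyLevel_monotone H hH (Fin.zero_le k.rev)

theorem energyLevel_one_le_eigenvalues (H : Op n) (hH : IsHermitian H) (k : Fin (2 ^ n))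
    (hk : k ≠ bottom n) :
    energyLevel H hH 1 ≤ hH.eigenvalues (finrank_qubits n) k := by
  have h0 : k.rev ≠ 0 := fun h => hk (by rw [← Fin.rev_rev k, h])
  have h1 : (1 : Fin (2 ^ n)) ≤ k.rev := Fin.one_le_of_ne_zero h0
  simpa [energyLevel] using energyLevel_monotone H hH h1

theorem spectralGap_nonneg (H : Op n) (hH : IsHermitian H) : 0 ≤ spectralGap H hH :=
  sub_nonneg.2 (energyLevel_monotone H hH (Fin.zero_le _))

theorem energyLevel_zero_mul_le (H : Op n) (hH : IsHermitian H) (x : Qubits n) :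
    energyLevel H hH 0 * ‖x‖ ^ 2 ≤ (⟪x, H x⟫_ℂ).re := by
  rw [re_inner_apply_eq_sum H hH, norm_sq_eq_sum H hH, Finset.mul_sum]
  exact Finset.sum_le_sum fun k _ =>
    mul_le_mul_of_nonneg_right (energyLevel_zero_le_eigenvalues H hH k) (sq_nonneg _)

theorem energyLevel_one_mul_le (H : Op n) (hH : IsHermitian H) (x : Qubits n)
    (hx : ⟪groundVector H hH, x⟫_ℂ = 0) :
    energyLevel H hH 1 * ‖x‖ ^ 2 ≤ (⟪x, H x⟫_ℂ).re := by
  rw [re_inner_apply_eq_sum H hH, norm_sq_eq_sum H hH, Finset.mul_sum]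
  refine Finset.sum_le_sum fun k _ => ?_
  by_cases hk : k = bottom n
  · rw [hk]
    change _ * ‖⟪groundVector H hH, x⟫_ℂ‖ ^ 2 ≤ _ * ‖⟪groundVector H hH, x⟫_ℂ‖ ^ 2
    simp [hx]
  · exact mul_le_mul_of_nonneg_right (energyLevel_one_le_eigenvalues H hH k hk) (sq_nonneg _)

/-- `φ` is a unit vector of minimal expectation value. -/
def IsMinimizer (H : Op n) (φ : Qubits n) : Prop :=
  ‖φ‖ = 1 ∧ ∀ x : Qubits n, (⟪φ, H φ⟫_ℂ).re * ‖x‖ ^ 2 ≤ (⟪x, H x⟫_ℂ).re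

theorem IsGroundState.re_inner_eq {H : Op n} {hH : IsHermitian H} {φ : Qubits n}
    (h : IsGroundState H hH φ) : (⟪φ, H φ⟫_ℂ).re = energyLevel H hH 0 := by
  rw [h.2, inner_smul_right, inner_self_eq_norm_sq_to_K, h.1]
  simp

theorem IsGroundState.isMinimizer {H : Op n} {hH : IsHermitian H} {φ : Qubits n}
    (h : IsGroundState H hH φ) : IsMinimizer H φ :=
  ⟨h.1, fun x => h.re_inner_eq ▸ energyLevel_zero_mul_le H hH x⟩

theorem IsMinimizer.re_inner_eq {H : Op n} {φ : Qubits n} (h : IsMinimizer H φ)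
    (hH : IsHermitian H) : (⟪φ, H φ⟫_ℂ).re = energyLevel H hH 0 := by
  have hg := isGroundState_groundVector H hH
  refine le_antisymm ?_ ?_
  · simpa [hg.1, hg.re_inner_eq] using h.2 (groundVector H hH)
  · simpa [h.1] using energyLevel_zero_mul_le H hH φ

/-- If the gap is positive, the ground state is unique up to a phase. -/
theorem IsMinimizer.eq_smul_groundVector {H : Op n} {φ : Qubits n} (h : IsMinimizer H φ)
    (hH : IsHermitian H) (hgap : 0 < spectralGap H hH) :
    ∃ c : ℂ, ‖c‖ = 1 ∧ φ = c • groundVector H hH := by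
  set e := hH.eigenvectorBasis (finrank_qubits n) with he
  have hz : ∀ k, k ≠ bottom n → ⟪e k, φ⟫_ℂ = 0 := by
    -- The energy of `φ` above the ground level is a sum of nonnegative terms that vanishes; a
    -- positive gap kills every coefficient off the bottom.
    have hsum : ∑ k, (hH.eigenvalues (finrank_qubits n) k - energyLevel H hH 0) *
        ‖⟪e k, φ⟫_ℂ‖ ^ 2 = 0 := by
      simp_rw [sub_mul]
      rw [Finset.sum_sub_distrib, ← re_inner_apply_eq_sum H hH, ← Finset.mul_sum,
        ← norm_sq_eq_sum H hH, h.1, h.re_inner_eq hH]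
      ring
    rw [Finset.sum_eq_zero_iff_of_nonneg fun k _ => mul_nonneg
      (sub_nonneg.2 (energyLevel_zero_le_eigenvalues H hH k)) (sq_nonneg _)] at hsum
    intro k hk
    have h1 := energyLevel_one_le_eigenvalues H hH k hk
    unfold spectralGap at hgap
    have h2 := (mul_eq_zero.1 (hsum k (Finset.mem_univ k))).resolve_left (by linarith)
    simpa using h2
  have hφ : φ = ⟪e (bottom n), φ⟫_ℂ • groundVector H hH := by
    conv_lhs => rw [← e.sum_repr' φ]
    rw [Finset.sum_eq_single (bottom n) (fun k _ hk => by rw [hz k hk, zero_smul]) (by simp)]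
    rfl
  refine ⟨_, ?_, hφ⟩
  have := h.1
  rw [hφ, norm_smul, (isGroundState_groundVector H hH).1, mul_one] at this
  exact this

/-! ### Intermediate values along the path -/

theorem interp_apply (H₀ H₁ : Op n) (s : ℝ) (x : Qubits n) :
    interp H₀ H₁ s x = ((1 - s : ℝ) : ℂ) • H₀ x + (s : ℂ) • H₁ x := rfl

theorem interp_zero (H₀ H₁ : Op n) : interp H₀ H₁ 0 = H₀ := by
  ext1 x
  simp [interp_apply]

theorem interp_one (H₀ H₁ : Op n) : interp H₀ H₁ 1 = H₁ := by
  ext1 x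
  simp [interp_apply]

theorem continuous_interp (H₀ H₁ : Op n) : Continuous (interp H₀ H₁) := by
  unfold interp
  fun_prop

/-- The variational form of a ground state is a family of conditions jointly closed in the parameter
and the vector, so neither eigenvalues nor eigenvectors need be followed continuously. -/
theorem isClosed_isMinimizer_interp (H₀ H₁ : Op n) :
    IsClosed {p : ℝ × Qubits n | IsMinimizer (interp H₀ H₁ p.1) p.2} := by
  have hc := continuous_interp H₀ H₁
  simp only [IsMinimizer, Set.ofPred_and, Set.ofPred_forall]
  refine (isClosed_eq (by fun_prop) (by fun_prop)).inter (isClosed_iInter fun x => ?_)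
  exact isClosed_le (by fun_prop) (by fun_prop)

/-- The parameters of `[0, 1]` at which some ground state lies in a given closed set. -/
theorem isClosed_setOf_exists_isMinimizer (H₀ H₁ : Op n) {C : Set (Qubits n)} (hC : IsClosed C) :
    IsClosed {s : ℝ | s ∈ Set.Icc 0 1 ∧ ∃ φ ∈ C, IsMinimizer (interp H₀ H₁ s) φ} := by
  have hK : IsCompact ((Set.Icc (0 : ℝ) 1 ×ˢ Metric.sphere (0 : Qubits n) 1) ∩
      ({p | p.2 ∈ C} ∩ {p | IsMinimizer (interp H₀ H₁ p.1) p.2})) :=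
    (isCompact_Icc.prod (isCompact_sphere _ _)).inter_right
      ((hC.preimage continuous_snd).inter (isClosed_isMinimizer_interp H₀ H₁))
  -- Unit vectors form a compact set, so projecting to the parameter preserves closedness.
  convert (hK.image continuous_fst).isClosed using 1
  ext s
  constructor
  · rintro ⟨hs, φ, hφ, hm⟩
    exact ⟨(s, φ), ⟨⟨hs, by simpa using hm.1⟩, hφ, hm⟩, rfl⟩
  · rintro ⟨⟨t, φ⟩, ⟨⟨hs, -⟩, hφ, hm⟩, rfl⟩
    exact ⟨hs, φ, hφ, hm⟩

/-- Along the interpolation, a continuous observable of the ground state takes intermediate values,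
in the sense that at some parameter there are ground states on both sides of the value. -/
theorem exists_isMinimizer_both_sides (H₀ H₁ : Op n) (h₀ : IsHermitian H₀) (h₁ : IsHermitian H₁)
    {f : Qubits n → ℝ} (hf : Continuous f) (c : ℝ) {α₀ α₁ : Qubits n}
    (hα₀ : IsMinimizer H₀ α₀) (hα₁ : IsMinimizer H₁ α₁) (hc₀ : c ≤ f α₀) (hc₁ : f α₁ ≤ c) :
    ∃ s ∈ Set.Icc (0 : ℝ) 1, ∃ φ φ', IsMinimizer (interp H₀ H₁ s) φ ∧
      IsMinimizer (interp H₀ H₁ s) φ' ∧ c ≤ f φ ∧ f φ' ≤ c := by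
  have hA := isClosed_setOf_exists_isMinimizer H₀ H₁ (isClosed_le continuous_const hf : IsClosed
    {x | c ≤ f x})
  have hB := isClosed_setOf_exists_isMinimizer H₀ H₁ (isClosed_le hf continuous_const : IsClosed
    {x | f x ≤ c})
  -- Two nonempty closed sets covering the connected interval must meet.
  obtain ⟨s, hs, ⟨-, φ, hφ, hm⟩, -, φ', hφ', hm'⟩ :=
    isPreconnected_closed_iff.1 (isPreconnected_Icc (a := (0 : ℝ)) (b := 1)) _ _ hA hB
      (fun s hs => by
        have hg := (isGroundState_groundVector _ (isHermitian_interp h₀ h₁ s)).isMinimizer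
        rcases le_total c (f (groundVector _ (isHermitian_interp h₀ h₁ s))) with h | h
        · exact Or.inl ⟨hs, _, h, hg⟩
        · exact Or.inr ⟨hs, _, h, hg⟩)
      ⟨0, by simp, by simp, α₀, hc₀, by rwa [interp_zero]⟩
      ⟨1, by simp, by simp, α₁, hc₁, by rwa [interp_one]⟩
  exact ⟨s, hs, φ, φ', hm, hm', hφ, hφ'⟩

/-! ### Escape rate and invariance of V -/

theorem SpannedByEigenstates.apply_mem {H : Op n} {V : Submodule ℂ (Qubits n)}
    (hV : SpannedByEigenstates H V) {v : Qubits n} (hv : v ∈ V) : H v ∈ V := by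
  obtain ⟨S, hS, rfl⟩ := hV
  induction hv using Submodule.span_induction with
  | mem x hx =>
    obtain ⟨μ, hμ⟩ := hS x hx
    have : H x = μ • x := hμ.apply_eq_smul
    rw [this]
    exact Submodule.smul_mem _ _ (Submodule.subset_span hx)
  | zero => simp
  | add x y _ _ hx hy => rw [map_add]; exact Submodule.add_mem _ hx hy
  | smul a x _ hx => rw [map_smul]; exact Submodule.smul_mem _ _ hx

theorem IsEscapeRate.nonneg {V : Submodule ℂ (Qubits n)} {H : Op n} {β : ℝ}
    (hβ : IsEscapeRate V H β) : 0 ≤ β := by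
  obtain ⟨⟨v, -, -, rfl⟩, -⟩ := hβ
  exact norm_nonneg _

theorem IsEscapeRate.norm_le {V : Submodule ℂ (Qubits n)} {H : Op n} {β : ℝ}
    (hβ : IsEscapeRate V H β) {v : Qubits n} (hv : v ∈ V) :
    ‖Vᗮ.starProjection (H v)‖ ≤ β * ‖v‖ := by
  rcases eq_or_ne v 0 with rfl | hv0
  · simp
  have hn : 0 < ‖v‖ := norm_pos_iff.2 hv0
  have := hβ.2 ⟨((‖v‖⁻¹ : ℝ) : ℂ) • v, V.smul_mem _ hv, by
    rw [norm_smul, Complex.norm_real, norm_inv, norm_norm, inv_mul_cancel₀ hn.ne'], rfl⟩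
  rw [map_smul, map_smul, norm_smul, Complex.norm_real, norm_inv, norm_norm] at this
  rwa [inv_mul_le_iff₀ hn, mul_comm] at this

/-- The escape rate is bounded by the distance to any operator that preserves the subspace. -/
theorem IsEscapeRate.le_norm_sub {V : Submodule ℂ (Qubits n)} {H₀ H₁ : Op n} {β : ℝ}
    (hβ : IsEscapeRate V H₁ β) (hV : SpannedByEigenstates H₀ V) : β ≤ ‖H₀ - H₁‖ := by
  obtain ⟨⟨v, hv, hv1, rfl⟩, -⟩ := hβ
  have hz : Vᗮ.starProjection (H₀ v) = 0 := by
    rw [Submodule.starProjection_apply_eq_zero_iff]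
    exact Submodule.le_orthogonal_orthogonal V (hV.apply_mem hv)
  have h2 : Vᗮ.starProjection (H₁ v) = -Vᗮ.starProjection ((H₀ - H₁) v) := by
    rw [sub_apply, map_sub, hz, zero_sub, neg_neg]
  rw [h2, norm_neg]
  calc _ ≤ ‖(H₀ - H₁) v‖ := Submodule.norm_starProjection_apply_le _ _
    _ ≤ ‖H₀ - H₁‖ * ‖v‖ := (H₀ - H₁).le_opNorm v
    _ = _ := by rw [hv1, mul_one]

/-- The interpolation couples `V` to its complement only through the escape rate. -/
theorem IsEscapeRate.norm_inner_interp_le {V : Submodule ℂ (Qubits n)} {H₀ H₁ : Op n} {β : ℝ}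
    (hβ : IsEscapeRate V H₁ β) (hV : SpannedByEigenstates H₀ V) {s : ℝ} (hs : s ∈ Set.Icc 0 1)
    {x y : Qubits n} (hx : x ∈ V) (hy : y ∈ Vᗮ) :
    ‖⟪interp H₀ H₁ s x, y⟫_ℂ‖ ≤ β * ‖x‖ * ‖y‖ := by
  have hz : ⟪H₀ x, y⟫_ℂ = 0 := hy _ (hV.apply_mem hx)
  have h1 : ⟪H₁ x, y⟫_ℂ = ⟪Vᗮ.starProjection (H₁ x), y⟫_ℂ := by
    rw [Submodule.inner_starProjection_left_eq_right, Submodule.starProjection_eq_self_iff.2 hy]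
  have h2 : ⟪interp H₀ H₁ s x, y⟫_ℂ = s * ⟪Vᗮ.starProjection (H₁ x), y⟫_ℂ := by
    rw [interp_apply, inner_add_left, inner_smul_left, inner_smul_left, hz, h1, mul_zero, zero_add,
      Complex.conj_ofReal]
  rw [h2, norm_mul, Complex.norm_real, Real.norm_of_nonneg hs.1]
  calc _ ≤ 1 * ‖⟪Vᗮ.starProjection (H₁ x), y⟫_ℂ‖ :=
        mul_le_mul_of_nonneg_right hs.2 (norm_nonneg _)
    _ ≤ ‖Vᗮ.starProjection (H₁ x)‖ * ‖y‖ := by rw [one_mul]; exact norm_inner_le_norm _ _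
    _ ≤ _ := mul_le_mul_of_nonneg_right (hβ.norm_le hx) (norm_nonneg _)

/-! ### Bounding the gap -/

/-- If a ground state has equal weight on `V` and on its complement, flipping the relative sign
gives an orthogonal state whose energy exceeds the ground energy by at most twice the escape
rate. -/
theorem spectralGap_le_of_balanced {V : Submodule ℂ (Qubits n)} {H₀ H₁ : Op n} {β : ℝ}
    (h₀ : IsHermitian H₀) (h₁ : IsHermitian H₁)
    (hβ : IsEscapeRate V H₁ β) (hV : SpannedByEigenstates H₀ V) {s : ℝ} (hs : s ∈ Set.Icc 0 1)
    (hgap : 0 < spectralGap (interp H₀ H₁ s) (isHermitian_interp h₀ h₁ s))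
    {φ : Qubits n} (hφ : IsMinimizer (interp H₀ H₁ s) φ)
    (hbal : ‖V.starProjection φ‖ ^ 2 = 1 / 2) :
    spectralGap (interp H₀ H₁ s) (isHermitian_interp h₀ h₁ s) ≤ 2 * β := by
  set H := interp H₀ H₁ s
  have hH : IsHermitian H := isHermitian_interp h₀ h₁ s
  set x := V.starProjection φ with hx
  set y := Vᗮ.starProjection φ with hy
  have hxV : x ∈ V := Submodule.starProjection_apply_mem _ _
  have hyV : y ∈ Vᗮ := Submodule.starProjection_apply_mem _ _
  have hxy : φ = x + y := (V.starProjection_add_starProjection_orthogonal φ).symm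
  have hxy0 : ⟪x, y⟫_ℂ = 0 := hyV x hxV
  have hyx0 : ⟪y, x⟫_ℂ = 0 := inner_eq_zero_symm.1 hxy0
  have hpy : ‖y‖ ^ 2 = 1 / 2 := by
    have h := V.norm_sq_eq_add_norm_sq_starProjection φ
    rw [hφ.1, ← hx, ← hy, hbal] at h
    linarith
  have hψn : ‖x - y‖ ^ 2 = 1 := by
    rw [@norm_sub_sq ℂ, hxy0, hbal, hpy]; norm_num
  have hψφ : ⟪φ, x - y⟫_ℂ = 0 := by
    rw [hxy, inner_add_left, inner_sub_right, inner_sub_right, hxy0, hyx0,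
      inner_self_eq_norm_sq_to_K, inner_self_eq_norm_sq_to_K]
    norm_cast
    rw [hbal, hpy]; norm_num
  obtain ⟨c, hc, hφc⟩ := hφ.eq_smul_groundVector hH hgap
  have hg : ⟪groundVector H hH, x - y⟫_ℂ = 0 := by
    rw [hφc, inner_smul_left] at hψφ
    refine (mul_eq_zero.1 hψφ).resolve_left fun h => ?_
    rw [← Complex.norm_conj, h, norm_zero] at hc
    exact zero_ne_one hc
  have hup := energyLevel_one_mul_le H hH _ hg
  have hlow := hφ.re_inner_eq hH
  rw [hψn, mul_one] at hup
  have hre : (⟪y, H x⟫_ℂ).re = (⟪H x, y⟫_ℂ).re := by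
    rw [← inner_conj_symm, Complex.conj_re]
  have hre' : (⟪x, H y⟫_ℂ).re = (⟪H x, y⟫_ℂ).re := by
    have h : ⟪H x, y⟫_ℂ = ⟪x, H y⟫_ℂ := hH x y
    rw [h]
  rw [hxy] at hlow
  simp only [map_add, map_sub, inner_add_left, inner_add_right, inner_sub_left, inner_sub_right,
    Complex.add_re, Complex.sub_re, hre, hre'] at hlow hup
  have hb := (Complex.abs_re_le_norm _).trans (hβ.norm_inner_interp_le hV hs hxV hyV)
  have hprod : ‖x‖ * ‖y‖ ≤ 1 / 2 := by nlinarith [sq_nonneg (‖x‖ - ‖y‖)]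
  have hb' : β * ‖x‖ * ‖y‖ ≤ β * (1 / 2) := by
    rw [mul_assoc]; exact mul_le_mul_of_nonneg_left hprod hβ.nonneg
  have := (abs_le.1 (hb.trans hb')).1
  change -(β * (1 / 2)) ≤ (⟪H x, y⟫_ℂ).re at this
  -- With r = Re⟪Hx, y⟫, the energies of x + y and x - y differ by 4r, so the gap is at most -4r ≤ 4
  -- · β/2.
  unfold spectralGap
  linarith

theorem minGap_le_spectralGap (H₀ H₁ : Op n) (h₀ : IsHermitian H₀) (h₁ : IsHermitian H₁)
    {s : ℝ} (hs : s ∈ Set.Icc (0 : ℝ) 1) :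
    minGap H₀ H₁ h₀ h₁ ≤ spectralGap (interp H₀ H₁ s) (isHermitian_interp h₀ h₁ s) :=
  ciInf_le (f := fun s : Set.Icc (0 : ℝ) 1 =>
    spectralGap (interp H₀ H₁ s) (isHermitian_interp h₀ h₁ s))
    ⟨0, by rintro _ ⟨t, rfl⟩; exact spectralGap_nonneg _ _⟩ ⟨s, hs⟩

/-- The minimal gap is at most twice the escape rate. -/
theorem minGap_le_two_mul_escapeRate {H₀ H₁ : Op n} (h₀ : IsHermitian H₀) (h₁ : IsHermitian H₁)
    {α₀ α₁ : Qubits n} (hα₀ : IsGroundState H₀ h₀ α₀) (hα₁ : IsGroundState H₁ h₁ α₁)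
    {V : Submodule ℂ (Qubits n)} (hV : SpannedByEigenstates H₀ V)
    (hV₀ : 1 / 2 ≤ ‖V.starProjection α₀‖ ^ 2) (hV₁ : ‖V.starProjection α₁‖ ^ 2 ≤ 1 / 2)
    {β : ℝ} (hβ : IsEscapeRate V H₁ β) : minGap H₀ H₁ h₀ h₁ ≤ 2 * β := by
  obtain ⟨s, hs, φ, φ', hφ, hφ', hge, hle⟩ := exists_isMinimizer_both_sides H₀ H₁ h₀ h₁
    (f := fun x => ‖V.starProjection x‖ ^ 2) (by fun_prop) (1 / 2)
    hα₀.isMinimizer hα₁.isMinimizer hV₀ hV₁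
  refine (minGap_le_spectralGap H₀ H₁ h₀ h₁ hs).trans ?_
  have hH := isHermitian_interp h₀ h₁ s
  rcases le_or_gt (spectralGap (interp H₀ H₁ s) hH) 0 with hgap | hgap
  · exact hgap.trans (mul_nonneg two_pos.le hβ.nonneg)
  · obtain ⟨c, hc, hφc⟩ := hφ.eq_smul_groundVector hH hgap
    obtain ⟨c', hc', hφc'⟩ := hφ'.eq_smul_groundVector hH hgap
    -- Both ground states agree up to a phase, so their common weight is squeezed to 1/2.
    have heq : ‖V.starProjection φ‖ = ‖V.starProjection φ'‖ := by
      rw [hφc, hφc', map_smul, map_smul, norm_smul, norm_smul, hc, hc']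
    have hbal : ‖V.starProjection φ‖ ^ 2 = 1 / 2 :=
      le_antisymm (by rw [heq]; exact hle) hge
    exact spectralGap_le_of_balanced h₀ h₁ hβ hV hs hgap hφ hbal

theorem minGap_nonneg (H₀ H₁ : Op n) (h₀ : IsHermitian H₀) (h₁ : IsHermitian H₁) :
    0 ≤ minGap H₀ H₁ h₀ h₁ :=
  Real.iInf_nonneg fun _ => spectralGap_nonneg _ _

end Adiabatic

theorem lemma2 (n : ℕ) (H₀ H₁ : Adiabatic.Op n)
    (h₀ : Adiabatic.IsHermitian H₀) (h₁ : Adiabatic.IsHermitian H₁)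
    (α₀ α₁ : Adiabatic.Qubits n)
    (hα₀ : Adiabatic.IsGroundState H₀ h₀ α₀) (hα₁ : Adiabatic.IsGroundState H₁ h₁ α₁)
    (V : Submodule ℂ (Adiabatic.Qubits n)) (hV : Adiabatic.SpannedByEigenstates H₀ V)
    (hV₀ : ‖V.starProjection α₀‖ = 1) (hV₁ : ‖V.starProjection α₁‖ ≤ 1 / 10)
    (β : ℝ) (hβ : Adiabatic.IsEscapeRate V H₁ β) :
    Adiabatic.minGap H₀ H₁ h₀ h₁ ≤ (100 * β * ‖H₀ - H₁‖ ^ 3) ^ (1 / 4 : ℝ) := by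
  have hΔ0 := Adiabatic.minGap_nonneg H₀ H₁ h₀ h₁
  have hΔβ := Adiabatic.minGap_le_two_mul_escapeRate h₀ h₁ hα₀ hα₁ hV
    (by rw [hV₀]; norm_num) (by nlinarith [norm_nonneg (V.starProjection α₁)]) hβ
  have hβ0 := hβ.nonneg
  have hβh := hβ.le_norm_sub hV
  have hcube : β ^ 3 ≤ ‖H₀ - H₁‖ ^ 3 := pow_le_pow_left₀ hβ0 hβh 3
  have hpow : Adiabatic.minGap H₀ H₁ h₀ h₁ ^ 4 ≤ 100 * β * ‖H₀ - H₁‖ ^ 3 :=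
    calc _ ≤ (2 * β) ^ 4 := pow_le_pow_left₀ hΔ0 hΔβ 4
      _ = 16 * β * β ^ 3 := by ring
      _ ≤ 100 * β * ‖H₀ - H₁‖ ^ 3 := by gcongr; norm_num
  calc _ = (Adiabatic.minGap H₀ H₁ h₀ h₁ ^ 4) ^ (1 / 4 : ℝ) := by
        rw [← Real.rpow_natCast, ← Real.rpow_mul hΔ0]; norm_num
    _ ≤ _ := Real.rpow_le_rpow (by positivity) hpow (by norm_num)
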